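/- Let $\beta>0$, $a>0$, $\mu\le 0$, $\nu>0$ and $\Delta\in\mathbb{R}$. For $\ell>0$ consider bosons in a cubic box $\Lambda_\ell\subset\mathbb{R}^3$ of side $\ell$ and volume $V_\ell=\ell^3$ with periodic boundary conditions. The single-particle modes are the momenta $\mathbf{p}\in\Lambda_\ell^*=\frac{2\pi}{\ell}\mathbb{Z}^3$. Let $\hat a_{\mathbf p}^\dagger,\hat a_{\mathbf p}$ be the creation and annihilation operators of the mode $\mathbf p$ on the boson Fock space $\mathcal F_B$, let $\hat n_{\mathbf p}=\hat a_{\mathbf p}^\dagger\hat a_{\mathbf p}$ and $\hat N=\sum_{\mathbf p}\hat n_{\mathbf p}$, and put $\lambda_\ell(\mathbf 0)=\Delta$ and $\lambda_\ell(\mathbf p)=\mathbf p^2/2$ for $\mathbf p\ne\mathbf 0$. Let $$\hat H_\ell^{\rm per}=\sum_{\mathbf p\in\Lambda_\ell^*}\lambda_\ell(\mathbf p)\,\hat n_{\mathbf p}+\frac{a}{V_\ell}\,\hat a_{\mathbf 0}^{\dagger 2}\hat a_{\mathbf 0}^{2}-2\nu\sqrt{V_\ell\,\hat n_{\mathbf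 0}} .$$ On the Fock space $\mathcal F_B'$ over the modes $\mathbf p\neq\mathbf 0$ let $\hat H_\ell^{0\prime}=\sum_{\mathbf p\ne\mathbf 0}\frac{\mathbf p^2}{2}\,\hat n_{\mathbf p}$ and $\hat N'=\sum_{\mathbf p\ne\mathbf 0}\hat n_{\mathbf p}$. Then, for every $\ell>0$, the operators $e^{-\beta(\hat H_\ell^{\rm per}-\mu\hat N)}$ and $e^{-\beta(\hat H_\ell^{0\prime}-\mu\hat N')}$ are of trace class. The limit $$p^{{\rm id}'}(\beta,\mu)=\lim_{\ell\to\infty}\frac{1}{\beta V_\ell}\log\operatorname{Tr}_{\mathcal F_B'}e^{-\beta(\hat H_\ell^{0\prime}-\mu\hat N')}$$ exists and is finite, and so does the limit pressure $$p^{\rm per}(\beta,\mu,\nu,\Delta)=\lim_{\ell\to\infty}\frac{1}{\beta V_\ell}\log\operatorname{Tr}_{\mathcal F_B}e^{-\beta(\hat H_\ell^{\rm per}-\mu\hat N)} .$$ Moreover, $$p^{\rm per}(\beta,\mu,\nu,\Delta)=g(z_0)+p^{{\rm id}'}(\beta,\mu),\qquad g(z)=-a z^2+(\mu-\Delta)z+2\nu\sqrt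 z\quad(z\ge 0),$$ where $z_0=z_0(\mu,\nu,\Delta)$ is the unique solution $z>0$ of $$z+\frac{\Delta-\mu}{2a}=\frac{\nu}{2a\sqrt z} .$$ -/

import Mathlib

noncomputable section

namespace BoseGas

/-! ### Exponentials of operators with an eigenbasis, and traces -/

section Hilbert

variable {E : Type} [NormedAddCommGroup E] [InnerProductSpace ℂ E] [CompleteSpace E]

/-- `T = exp (-β K)`: there is an orthonormal basis of eigenvectors of the (unbounded) operator
`K`, with real eigenvalues `ε i`, and the bounded operator `T` acts on the `i`-th basis vector as
multiplication by `exp (-β ε i)`.  For symmetric `K` there is at most one such `T`. -/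
def IsExpNeg (β : ℝ) (K : E →ₗ.[ℂ] E) (T : E →L[ℂ] E) : Prop :=
  ∃ (ι : Type) (b : HilbertBasis ι ℂ E) (ε : ι → ℝ),
    ∀ i, (∃ h : b i ∈ K.domain, K ⟨b i, h⟩ = (ε i : ℂ) • b i) ∧
      T (b i) = (Real.exp (-β * ε i) : ℂ) • b i

open Classical in
/-- The operator `exp (-β K)`; it is `0` if there is no such bounded operator. -/
def expNeg (β : ℝ) (K : E →ₗ.[ℂ] E) : E →L[ℂ] E :=
  if h : ∃ T, IsExpNeg β K T then h.choose else 0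

/-- `T` has trace `z`: the diagonal matrix elements of `T` sum (unconditionally) to `z` in every
orthonormal basis. -/
def HasTrace (T : E →L[ℂ] E) (z : ℂ) : Prop :=
  ∀ (ι : Type) (b : HilbertBasis ι ℂ E), HasSum (fun i => inner ℂ (b i) (T (b i))) z

open Classical in
/-- The trace of `T`; it is `0` if `T` has none. -/
def trace (T : E →L[ℂ] E) : ℂ :=
  if h : ∃ z, HasTrace T z then h.choose else 0

/-- `exp (-β K)` exists as a bounded operator, and it has a trace. -/
def HasGibbsState (β : ℝ) (K : E →ₗ.[ℂ] E) : Prop :=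
  (∃ T, IsExpNeg β K T) ∧ ∃ z, HasTrace (expNeg β K) z

/-- The grand-canonical pressure `(β V)⁻¹ log Tr exp (-β K)` in the volume `V`, where
`K = H - μ N`. -/
def pressure (β V : ℝ) (K : E →ₗ.[ℂ] E) : ℝ :=
  1 / (β * V) * Real.log (trace (expNeg β K)).re

end Hilbert

/-! ### The boson Fock space over a set `M` of modes, in the occupation-number representation -/

/-- Occupation numbers of the modes, all but finitely many of them zero. -/
abbrev Occ (M : Type) : Type := M →₀ ℕ

/-- The boson Fock space with orthonormal basis of number states `|n⟩`, `n : Occ M`. -/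
abbrev Fock (M : Type) : Type := lp (fun _ : Occ M => ℂ) 2

/-- Linear maps on all amplitude functions `ψ n = ⟨n, ψ⟩`, square summable or not.  Polynomials in
creation and annihilation operators can be formed here without domain questions. -/
abbrev FormalOp (M : Type) : Type := Module.End ℂ (Occ M → ℂ)

section Modes

variable {M : Type}

/-- The annihilation operator: `a_p |n⟩ = √(n_p) |n - δ_p⟩`. -/
def annihilation (p : M) : FormalOp M where
  toFun ψ n := (√((n p : ℝ) + 1) : ℂ) * ψ (n + Finsupp.single p 1)
  map_add' ψ φ := by ext n; simp [mul_add]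
  map_smul' c ψ := by ext n; simp [mul_left_comm]

/-- The creation operator: `a†_p |n⟩ = √(n_p + 1) |n + δ_p⟩`. -/
def creation (p : M) : FormalOp M where
  toFun ψ n := (√(n p : ℝ) : ℂ) * ψ (n - Finsupp.single p 1)
  map_add' ψ φ := by ext n; simp [mul_add]
  map_smul' c ψ := by ext n; simp [mul_left_comm]

/-- The number operator `n̂_p = a†_p a_p`. -/
def number (p : M) : FormalOp M := creation p * annihilation p

lemma number_apply (p : M) (ψ : Occ M → ℂ) (n : Occ M) : number p ψ n = (n p : ℂ) * ψ n := by
  simp only [number, creation, annihilation, Module.End.mul_apply, LinearMap.coe_mk,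
    AddHom.coe_mk]
  rcases Nat.eq_zero_or_pos (n p) with h | h
  · simp [h]
  · have h1 : n - Finsupp.single p 1 + Finsupp.single p 1 = n :=
      tsub_add_cancel_of_le (Finsupp.single_le_iff.mpr h)
    have h2 : (((n - Finsupp.single p 1 : Occ M) p : ℕ) : ℝ) + 1 = (n p : ℝ) := by
      have h3 := DFunLike.congr_fun h1 p
      simp only [Finsupp.add_apply, Finsupp.single_eq_same] at h3
      exact_mod_cast h3
    rw [h1, h2, ← mul_assoc, ← Complex.ofReal_mul, Real.mul_self_sqrt (Nat.cast_nonneg _)]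
    simp

/-- The function `f` of the number operator `n̂_p`, namely `f(n̂_p) |n⟩ = f(n_p) |n⟩`. -/
def funNumber (f : ℝ → ℝ) (p : M) : FormalOp M where
  toFun ψ n := (f (n p) : ℂ) * ψ n
  map_add' ψ φ := by ext n; simp [mul_add]
  map_smul' c ψ := by ext n; simp [mul_left_comm]

/-- `∑_p e(p) n̂_p` over all modes.  In the component `n` only the finitely many modes with
`n_p ≠ 0` contribute, by `number_apply`. -/
def modeSum (e : M → ℝ) : FormalOp M where
  toFun ψ n := ∑ p ∈ n.support, (e p : ℂ) * number p ψ n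
  map_add' ψ φ := by ext n; simp [mul_add, Finset.sum_add_distrib]
  map_smul' c ψ := by ext n; simp [mul_left_comm, Finset.mul_sum]

/-- The total number operator `∑_p n̂_p`. -/
def totalNumber : FormalOp M := modeSum fun _ => 1

/-- The operator on Fock space given by `A`, on its maximal domain
`{ψ ∈ ℓ² | A ψ ∈ ℓ²}`. -/
def onFock (A : FormalOp M) : Fock M →ₗ.[ℂ] Fock M where
  domain :=
    { carrier := {ψ | Memℓp (A ψ) 2}
      add_mem' := by
        intro ψ φ hψ hφ
        have h := Memℓp.add hψ hφ
        rw [← map_add] at h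
        exact h
      zero_mem' := by
        have h : A (fun _ => 0) = 0 := map_zero A
        change Memℓp (A (fun _ => 0)) 2
        rw [h]
        exact zero_memℓp
      smul_mem' := by
        intro c ψ hψ
        have h := Memℓp.const_smul hψ c
        rw [← map_smul] at h
        exact h }
  toFun :=
    { toFun := fun ψ => ⟨A ψ.1, ψ.2⟩
      map_add' := fun ψ φ => Subtype.ext (map_add A (ψ.1 : Occ M → ℂ) (φ.1 : Occ M → ℂ))
      map_smul' := fun c ψ => Subtype.ext (map_smul A c (ψ.1 : Occ M → ℂ)) }

end Modes

/-! ### The model in the cubic box of side `ℓ` with periodic boundary conditions -/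

/-- The integer vector `k` labels the momentum `2πk/ℓ`. -/
abbrev Mode : Type := Fin 3 → ℤ

/-- The momentum `p = 2πk/ℓ`. -/
def momentum (ℓ : ℝ) (k : Mode) : EuclideanSpace ℝ (Fin 3) :=
  WithLp.toLp 2 fun α => 2 * Real.pi * (k α : ℝ) / ℓ

/-- The one-particle energies: `Δ` for the zero mode, and `p²/2` for the other ones. -/
def energy (ℓ Δ : ℝ) (k : Mode) : ℝ :=
  if k = 0 then Δ else ‖momentum ℓ k‖ ^ 2 / 2

/-- The volume of the box. -/
def vol (ℓ : ℝ) : ℝ := ℓ ^ 3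

/-- `H^per = ∑_p λ(p) n̂_p + (a/V) a₀†² a₀² - 2ν √(V n̂₀)`. -/
def perturbedHamiltonian (ℓ Δ a ν : ℝ) : FormalOp Mode :=
  modeSum (energy ℓ Δ)
    + ((a / vol ℓ : ℝ) : ℂ) • (creation 0 ^ 2 * annihilation 0 ^ 2)
    - ((2 * ν : ℝ) : ℂ) • funNumber (fun x => √(vol ℓ * x)) 0

/-- The self-adjoint operator `H^per - μ N` on the Fock space over all the modes. -/
def perturbedGrand (ℓ Δ a ν μ : ℝ) : Fock Mode →ₗ.[ℂ] Fock Mode :=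
  onFock (perturbedHamiltonian ℓ Δ a ν - (μ : ℂ) • totalNumber)

/-- The modes other than the zero mode. -/
abbrev NonzeroMode : Type := {k : Mode // k ≠ 0}

/-- The ideal-gas Hamiltonian `∑_{p ≠ 0} (p²/2) n̂_p` without the zero mode. -/
def idealHamiltonian' (ℓ : ℝ) : FormalOp NonzeroMode :=
  modeSum fun k => ‖momentum ℓ k.1‖ ^ 2 / 2

/-- The self-adjoint operator `H' - μ N'` on the Fock space over the nonzero modes. -/
def idealGrand' (ℓ μ : ℝ) : Fock NonzeroMode →ₗ.[ℂ] Fock NonzeroMode :=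
  onFock (idealHamiltonian' ℓ - (μ : ℂ) • totalNumber)

/-- `g(z) = -a z² + (μ - Δ) z + 2ν √z`. -/
def g (a μ ν Δ z : ℝ) : ℝ := -a * z ^ 2 + (μ - Δ) * z + 2 * ν * √z

/-- `z` is a positive solution of `z + (Δ - μ)/(2a) = ν/(2a √z)`. -/
def IsPositiveRoot (a μ ν Δ z : ℝ) : Prop :=
  0 < z ∧ z + (Δ - μ) / (2 * a) = ν / (2 * a * √z)

end BoseGas

end

open Filter Topology BoseGas

/-! Both operators are diagonal in the number states, so their Gibbs operators are diagonal too and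
the traces are sums of Boltzmann weights over occupation numbers (`hasGibbsState_diagonal`). The
perturbation involves only the zero mode, hence the weight is a function of `n 0` times the ideal
weight of the other modes. The partition function factorises (`hasSum_exp_perturbed`) and the two
pressures add.

The zero-mode factor is a Laplace sum: with `z = m / V` the exponent is `β V g(z)` plus a term
linear in `z`, and `g` is strictly concave with its maximum at `z₀`. A quadratic gap below the
maximum (`g_le`) bounds the sum above, and the single term `m = ⌊z₀ V⌋` bounds it below.

For the other modes, the logarithm of the product of geometric series expands into windings, `-log
(1 - x) = ∑ x ^ (j + 1) / (j + 1)`. Each winding is a cubed one-dimensional Gaussian sum minus the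
zero mode. Divided by the volume it converges, and it is dominated by a multiple of `(j + 1) ^
(-3/2)` (`windingTerm_le`), so the series converges even at `μ = 0`. -/

open Filter Topology BoseGas

/-! ### Gibbs states of diagonal operators -/

section Diagonal

variable {M : Type}

/-- The standard basis of the Fock space, consisting of number states. -/
noncomputable def numberBasis (M : Type) : HilbertBasis (Occ M) ℂ (Fock M) :=
  HilbertBasis.ofRepr (LinearIsometryEquiv.refl ℂ _)

lemma numberBasis_apply [DecidableEq (Occ M)] (n : Occ M) :
    numberBasis M n = lp.single 2 n (1 : ℂ) := by
  rw [← HilbertBasis.repr_symm_single]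
  rfl

lemma inner_numberBasis (n : Occ M) (ψ : Fock M) : inner ℂ (numberBasis M n) ψ = ψ n := by
  rw [← HilbertBasis.repr_apply_apply]
  rfl

lemma memℓp_mul_of_bounded {w : Occ M → ℂ} {C : ℝ} (hw : ∀ n, ‖w n‖ ≤ C) (ψ : Fock M) :
    Memℓp (fun n => w n * ψ n) 2 := by
  have hψ := (lp.memℓp ψ).summable (by norm_num)
  refine memℓp_gen ?_
  refine Summable.of_nonneg_of_le (fun n => by positivity) (fun n => ?_) (hψ.mul_left (C ^ 2))
  have hC : (0 : ℝ) ≤ C := (norm_nonneg _).trans (hw n)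
  simp only [ENNReal.toReal_ofNat, Real.rpow_two, norm_mul, mul_pow]
  gcongr
  exact hw n

/-- Multiplication of amplitudes by a bounded function, as a bounded operator. -/
noncomputable def diagonalCLM (w : Occ M → ℂ) (C : ℝ) (hw : ∀ n, ‖w n‖ ≤ C) : Fock M →L[ℂ] Fock M :=
  LinearMap.mkContinuous
    { toFun := fun ψ => ⟨fun n => w n * ψ n, memℓp_mul_of_bounded hw ψ⟩
      map_add' := fun ψ φ => by ext n; exact mul_add _ _ _
      map_smul' := fun c ψ => by ext n; simp [mul_left_comm] } C (by
    intro ψ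
    have hC : (0 : ℝ) ≤ C := (norm_nonneg _).trans (hw 0)
    refine lp.norm_le_of_tsum_le (by norm_num) (by positivity) ?_
    have hψ := (lp.memℓp ψ).summable (by norm_num)
    have h := lp.norm_rpow_eq_tsum (p := 2) (by norm_num) ψ
    simp only [ENNReal.toReal_ofNat, Real.rpow_two] at h hψ ⊢
    rw [mul_pow, h, ← tsum_mul_left]
    have hle : ∀ n, ‖w n * ψ n‖ ^ 2 ≤ C ^ 2 * ‖ψ n‖ ^ 2 := fun n => by
      rw [norm_mul, mul_pow]
      gcongr
      exact hw n
    exact Summable.tsum_le_tsum hle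
      (Summable.of_nonneg_of_le (fun n => by positivity) hle (hψ.mul_left _)) (hψ.mul_left _))

@[simp] lemma diagonalCLM_apply (w : Occ M → ℂ) (C : ℝ) (hw : ∀ n, ‖w n‖ ≤ C) (ψ : Fock M)
    (n : Occ M) : diagonalCLM w C hw ψ n = w n * ψ n := rfl

lemma isExpNeg_diagonal {A : FormalOp M} {E : Occ M → ℝ}
    (hA : ∀ ψ n, A ψ n = (E n : ℂ) * ψ n) {β C : ℝ}
    (hC : ∀ n, ‖(Real.exp (-β * E n) : ℂ)‖ ≤ C) :
    IsExpNeg β (onFock A) (diagonalCLM _ C hC) := by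
  classical
  refine ⟨Occ M, numberBasis M, E, fun n => ⟨?_, ?_⟩⟩
  · have hkey : A (numberBasis M n : Occ M → ℂ) = ((E n : ℂ) • numberBasis M n : Fock M) := by
      ext m
      rw [hA, numberBasis_apply, lp.coeFn_smul, Pi.smul_apply, smul_eq_mul]
      by_cases h : m = n
      · rw [h]
      · rw [lp.single_apply_ne _ _ _ h]; simp
    have hmem : numberBasis M n ∈ (onFock A).domain := by
      change Memℓp (A (numberBasis M n : Occ M → ℂ)) 2
      rw [hkey]
      exact lp.memℓp _
    exact ⟨hmem, lp.ext hkey⟩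
  · ext m
    rw [diagonalCLM_apply, numberBasis_apply, lp.coeFn_smul, Pi.smul_apply, smul_eq_mul]
    by_cases h : m = n
    · rw [h]
    · rw [lp.single_apply_ne _ _ _ h]; simp

/-- `expNeg` is a choice whose eigenbasis need not be the number basis, so uniqueness is needed. An
eigenvector of eigenvalue `ε` has nonzero amplitudes only where `E n = ε`; the diagonal operator
therefore multiplies it by `exp (-β ε)`, and the eigenvectors span a dense subspace. -/
lemma IsExpNeg.eq_diagonal {A : FormalOp M} {E : Occ M → ℝ}
    (hA : ∀ ψ n, A ψ n = (E n : ℂ) * ψ n) {β C : ℝ}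
    (hC : ∀ n, ‖(Real.exp (-β * E n) : ℂ)‖ ≤ C) {T : Fock M →L[ℂ] Fock M}
    (hT : IsExpNeg β (onFock A) T) : T = diagonalCLM _ C hC := by
  obtain ⟨ι, b, ε, h⟩ := hT
  refine ContinuousLinearMap.ext_on (s := Set.range b)
    (Submodule.dense_iff_topologicalClosure_eq_top.mpr b.dense_span) ?_
  rintro _ ⟨i, rfl⟩
  obtain ⟨⟨hmem, hK⟩, hTi⟩ := h i
  rw [hTi]
  ext n
  have hn : (E n : ℂ) * b i n = (ε i : ℂ) * b i n := by
    rw [← hA]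
    exact congrFun (congrArg (fun φ : Fock M => (φ : Occ M → ℂ)) hK) n
  rw [diagonalCLM_apply, lp.coeFn_smul, Pi.smul_apply, smul_eq_mul]
  by_cases h0 : b i n = 0
  · simp [h0]
  · have := mul_right_cancel₀ h0 hn
    rw [Complex.ofReal_inj.mp this]

/-- In any basis the trace is the iterated sum of the nonnegative terms `w n * ‖b i n‖ ^ 2`.
Parseval for `|n⟩` evaluates the sum over `i` as `w n`, and nonnegativity permits exchanging the
order. -/
lemma hasTrace_diagonal {w : Occ M → ℝ} (hw0 : ∀ n, 0 ≤ w n) {z : ℝ} (hw : HasSum w z) {C : ℝ}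
    (hC : ∀ n, ‖(w n : ℂ)‖ ≤ C) : HasTrace (diagonalCLM (fun n => (w n : ℂ)) C hC) (z : ℂ) := by
  intro ι b
  have hrow : ∀ n : Occ M, HasSum (fun i => w n * ‖b i n‖ ^ 2) (w n) := fun n => by
    have h := b.hasSum_inner_mul_inner (numberBasis M n) (numberBasis M n)
    simp only [inner_numberBasis] at h
    have h1 : (numberBasis M n : Fock M) n = 1 := by
      classical
      rw [numberBasis_apply, lp.single_apply_self]
    have h2 : ∀ i, b i n * inner ℂ (b i) (numberBasis M n) = ((‖b i n‖ ^ 2 : ℝ) : ℂ) := fun i => by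
      rw [← inner_conj_symm, inner_numberBasis, Complex.mul_conj, Complex.normSq_eq_norm_sq]
    rw [h1] at h
    simp only [h2] at h
    have h3 : HasSum (fun i => ‖b i n‖ ^ 2) 1 := by
      rw [← Complex.hasSum_ofReal]
      simpa using h
    simpa using h3.mul_left (w n)
  have hprod : Summable fun x : Occ M × ι => w x.1 * ‖b x.2 x.1‖ ^ 2 := by
    rw [summable_prod_of_nonneg (fun x => by have := hw0 x.1; positivity)]
    exact ⟨fun n => (hrow n).summable, by simpa only [(hrow _).tsum_eq] using hw.summable⟩
  have htot : HasSum (fun x : Occ M × ι => w x.1 * ‖b x.2 x.1‖ ^ 2) z := by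
    have h := hprod.hasSum
    rwa [(h.prod_fiberwise hrow).unique hw] at h
  have hinner : ∀ i, inner ℂ (b i) (diagonalCLM (fun n => (w n : ℂ)) C hC (b i))
      = ((∑' n, w n * ‖b i n‖ ^ 2 : ℝ) : ℂ) := fun i => by
    rw [lp.inner_eq_tsum, Complex.ofReal_tsum]
    refine tsum_congr fun n => ?_
    rw [diagonalCLM_apply, RCLike.inner_apply', mul_left_comm, Complex.conj_mul']
    push_cast
    rfl
  simp only [hinner]
  rw [Complex.hasSum_ofReal]
  have hswap := (Equiv.prodComm ι (Occ M)).hasSum_iff.mpr htot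
  exact hswap.prod_fiberwise fun i => (hswap.summable.prod_factor i).hasSum

lemma hasGibbsState_diagonal {A : FormalOp M} {E : Occ M → ℝ}
    (hA : ∀ ψ n, A ψ n = (E n : ℂ) * ψ n) {β z : ℝ}
    (hz : HasSum (fun n => Real.exp (-β * E n)) z) :
    HasGibbsState β (onFock A) ∧ trace (expNeg β (onFock A)) = z := by
  -- Positive weights with sum `z` are each at most `z`, which gives boundedness of the operator.
  have hC : ∀ n, ‖(Real.exp (-β * E n) : ℂ)‖ ≤ z := fun n => by
    rw [Complex.norm_real, Real.norm_of_nonneg (Real.exp_pos _).le]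
    exact le_hasSum hz n fun _ _ => (Real.exp_pos _).le
  have hex : ∃ T, IsExpNeg β (onFock A) T := ⟨_, isExpNeg_diagonal hA hC⟩
  have heq : expNeg β (onFock A) = diagonalCLM _ z hC := by
    rw [expNeg, dif_pos hex]
    exact IsExpNeg.eq_diagonal hA hC hex.choose_spec
  have htr : HasTrace (expNeg β (onFock A)) z := by
    rw [heq]
    exact hasTrace_diagonal (fun _ => (Real.exp_pos _).le) hz hC
  have hex' : ∃ y, HasTrace (expNeg β (onFock A)) y := ⟨_, htr⟩
  refine ⟨⟨hex, hex'⟩, ?_⟩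
  rw [trace, dif_pos hex']
  exact (hex'.choose_spec _ (numberBasis M)).unique (htr _ (numberBasis M))

end Diagonal

/-! ### Occupation-number sums -/

section OccupationSums

lemma hasSum_option_occupation {M : Type} {f : ℕ → ℝ} {F : (M →₀ ℕ) → ℝ} {s t : ℝ}
    (hf0 : ∀ m, 0 ≤ f m) (hF0 : ∀ n, 0 ≤ F n) (hf : HasSum f s) (hF : HasSum F t) :
    HasSum (fun n : Option M →₀ ℕ => f (n none) * F n.some) (s * t) := by
  rw [← Finsupp.optionEquiv.symm.hasSum_iff]
  have h := hf.mul hF (hf.summable.mul_of_nonneg hF.summable hf0 hF0)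
  refine h.congr_fun ?_
  rintro ⟨m, n⟩
  have h1 : (Finsupp.optionEquiv.symm (m, n) : Option M →₀ ℕ) none = m :=
    Finsupp.optionElim_apply_none m n
  have h2 : (Finsupp.optionEquiv.symm (m, n) : Option M →₀ ℕ).some = n :=
    Finsupp.some_optionElim m n
  simp only [Function.comp, h1, h2]

lemma hasSum_prod_pow_of_fintype {M : Type} [Fintype M] {x : M → ℝ}
    (hx0 : ∀ p, 0 ≤ x p) (hx1 : ∀ p, x p < 1) :
    HasSum (fun n : M →₀ ℕ => n.prod fun p k => x p ^ k) (∏ p, (1 - x p)⁻¹) := by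
  suffices h : ∀ x : M → ℝ, (∀ p, 0 ≤ x p) → (∀ p, x p < 1) →
      HasSum (fun n : M →₀ ℕ => n.prod fun p k => x p ^ k) (∏ p, (1 - x p)⁻¹) from h x hx0 hx1
  refine Fintype.induction_empty_option (P := fun M _ => ∀ x : M → ℝ, (∀ p, 0 ≤ x p) →
    (∀ p, x p < 1) → HasSum (fun n : M →₀ ℕ => n.prod fun p k => x p ^ k) (∏ p, (1 - x p)⁻¹))
    ?_ ?_ ?_ M
  · intro α β _ e ih x hx0 hx1
    let := Fintype.ofEquiv β e.symm
    have h := ih (x ∘ e) (fun p => hx0 _) (fun p => hx1 _)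
    rw [← (Finsupp.domCongr e).toEquiv.hasSum_iff]
    rw [← e.prod_comp]
    exact h.congr_fun fun n => Finsupp.prod_equivMapDomain _ _ _
  · intro x _ _
    simp
  · intro α _ ih x hx0 hx1
    have h := hasSum_option_occupation (fun m => pow_nonneg (hx0 none) m)
      (fun n : α →₀ ℕ => Finset.prod_nonneg fun p _ => pow_nonneg (hx0 (some p)) (n p))
      (hasSum_geometric_of_lt_one (hx0 none) (hx1 none))
      (ih (fun p => x (some p)) (fun p => hx0 (some p)) (fun p => hx1 (some p)))
    rw [Fintype.prod_option]
    convert h using 2 with n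
    exact Finsupp.prod_option_index _ _ (fun _ => pow_zero _) fun _ _ _ => pow_add _ _ _

/-- An Euler product. Occupations supported in a finite `S` sum to the product over `S`. Any finite
set of occupations lives in such an `S`, which gives the upper bound; letting `S` grow gives the
lower one. -/
lemma hasSum_prod_pow {M : Type} {x : M → ℝ} (hx0 : ∀ p, 0 ≤ x p) (hx1 : ∀ p, x p < 1) {L : ℝ}
    (hL : HasSum (fun p => -Real.log (1 - x p)) L) :
    HasSum (fun n : M →₀ ℕ => n.prod fun p k => x p ^ k) (Real.exp L) := by
  classical
  set F : (M →₀ ℕ) → ℝ := fun n => n.prod fun p k => x p ^ k with hF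
  have hF0 : 0 ≤ F := fun n => Finset.prod_nonneg fun p _ => pow_nonneg (hx0 p) _
  have hlog0 : ∀ p, 0 ≤ -Real.log (1 - x p) := fun p => by
    have := Real.log_nonpos (sub_nonneg.mpr (hx1 p).le) (by linarith [hx0 p])
    linarith
  have hexp : ∀ S : Finset M, ∏ p : (S : Set M), (1 - x p)⁻¹ = Real.exp (∑ p ∈ S, -Real.log (1 - x p)) :=
    fun S => by
      refine (Finset.prod_coe_sort S (fun p => (1 - x p)⁻¹)).trans ?_
      rw [Real.exp_sum]
      refine Finset.prod_congr rfl fun p _ => ?_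
      rw [Real.exp_neg, Real.exp_log (sub_pos.mpr (hx1 p))]
  have hS : ∀ S : Finset M, HasSum (fun n : {n : M →₀ ℕ // ↑n.support ⊆ (S : Set M)} => F n)
      (Real.exp (∑ p ∈ S, -Real.log (1 - x p))) := fun S => by
    rw [← hexp]
    have h := hasSum_prod_pow_of_fintype (x := fun p : (S : Set M) => x p) (fun p => hx0 p) (fun p => hx1 p)
    rw [← (Finsupp.restrictSupportEquiv (S : Set M) ℕ).hasSum_iff] at h
    convert h using 2 with n
    exact (Finsupp.prod_subtypeDomain_index (h := fun p k => x p ^ k) fun p hp => n.2 hp).symm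
  have hle : ∀ u : Finset (M →₀ ℕ), ∑ n ∈ u, F n ≤ Real.exp L := fun u => by
    set S := u.biUnion Finsupp.support with hSdef
    have hsub : ∀ n ∈ u, (n.support : Set M) ⊆ S := fun n hn =>
      Finset.coe_subset.mpr (Finset.subset_biUnion_of_mem _ hn)
    calc ∑ n ∈ u, F n
        = ∑ n ∈ u.subtype (fun n => (n.support : Set M) ⊆ S), F n :=
          (Finset.sum_subtype_of_mem F hsub).symm
      _ ≤ Real.exp (∑ p ∈ S, -Real.log (1 - x p)) :=
          sum_le_hasSum _ (fun n _ => hF0 n) (hS S)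
      _ ≤ Real.exp L := Real.exp_le_exp.mpr (sum_le_hasSum _ (fun p _ => hlog0 p) hL)
  have hsum : Summable F := summable_of_sum_le hF0 hle
  have hge : Real.exp L ≤ ∑' n, F n := by
    refine le_of_tendsto (Real.continuous_exp.continuousAt.tendsto.comp hL)
      (Eventually.of_forall fun S => ?_)
    simp only [Function.comp]
    rw [← (hS S).tsum_eq]
    exact hsum.tsum_subtype_le F _ hF0
  have heq : ∑' n, F n = Real.exp L := le_antisymm (hsum.tsum_le_of_sum_le hle) hge
  rw [← heq]
  exact hsum.hasSum

/-- Products over finitely many coordinates of summable functions. -/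
lemma hasSum_prod_fin {κ : Type} {f : κ → ℝ} {s : ℝ} (hf0 : ∀ k, 0 ≤ f k) (hf : HasSum f s)
    (d : ℕ) : HasSum (fun k : Fin d → κ => ∏ i, f (k i)) (s ^ d) := by
  induction d with
  | zero => simp
  | succ d ih =>
    rw [← (Fin.consEquiv fun _ : Fin (d + 1) => κ).hasSum_iff, pow_succ']
    have h0 : ∀ k : Fin d → κ, 0 ≤ ∏ i, f (k i) := fun k => Finset.prod_nonneg fun i _ => hf0 _
    generalize hF : (fun k : Fin d → κ => ∏ i, f (k i)) = F at ih
    replace h0 : 0 ≤ F := hF ▸ h0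
    have h := hf.mul ih (hf.summable.mul_of_nonneg ih.summable hf0 h0)
    subst hF
    refine h.congr_fun fun k => ?_
    simp [Fin.consEquiv, Fin.prod_univ_succ]

end OccupationSums

/-! ### Gaussian lattice sums -/

section Theta

lemma summable_exp_neg_mul_int_sq {t : ℝ} (ht : 0 < t) :
    Summable fun k : ℤ => Real.exp (-t * (k : ℝ) ^ 2) := by
  have hnat : Summable fun k : ℕ => Real.exp (-t * (k : ℝ) ^ 2) := by
    refine Summable.of_nonneg_of_le (fun k => (Real.exp_pos _).le) (fun k => ?_)
      (Real.summable_exp_nat_mul_iff.mpr (neg_lt_zero.mpr ht))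
    refine Real.exp_le_exp.mpr ?_
    have : (k : ℝ) ≤ (k : ℝ) ^ 2 := by exact_mod_cast Nat.le_self_pow two_ne_zero k
    nlinarith
  refine Summable.of_nat_of_neg ?_ ?_ <;> simpa using hnat

/-- The one-dimensional Gaussian lattice sum. -/
noncomputable def gaussianSum (t : ℝ) : ℝ := ∑' k : ℤ, Real.exp (-t * (k : ℝ) ^ 2)

lemma one_le_gaussianSum {t : ℝ} (ht : 0 < t) : 1 ≤ gaussianSum t := by
  have := (summable_exp_neg_mul_int_sq ht).le_tsum 0 fun _ _ => (Real.exp_pos _).le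
  simpa [gaussianSum] using this

/-- By Poisson summation the sum is `√(π / t)` times a dual Gaussian sum, whose zero term alone is
`1`. -/
lemma sqrt_pi_div_le_gaussianSum {t : ℝ} (ht : 0 < t) :
    √(Real.pi / t) ≤ gaussianSum t := by
  have hpi := Real.pi_pos
  have h := Real.tsum_exp_neg_mul_int_sq (div_pos ht hpi)
  have h1 : -Real.pi * (t / Real.pi) = -t := by field_simp
  have h2 : (1 : ℝ) / (t / Real.pi) ^ (1 / 2 : ℝ) = √(Real.pi / t) := by
    rw [← Real.sqrt_eq_rpow, one_div, ← Real.sqrt_inv, inv_div]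
  rw [h1, h2] at h
  rw [gaussianSum, h]
  refine le_mul_of_one_le_right (Real.sqrt_nonneg _) ?_
  have hs : Summable fun k : ℤ => Real.exp (-Real.pi / (t / Real.pi) * (k : ℝ) ^ 2) := by
    have := summable_exp_neg_mul_int_sq (t := Real.pi / (t / Real.pi)) (by positivity)
    simpa only [neg_div] using this
  have := hs.le_tsum 0 fun _ _ => (Real.exp_pos _).le
  simpa using this

/-- Each half of the sum, without its zero term, is at most the Gaussian integral over the
half-line. The gap of `1` to the lower bound vanishes after division by `ℓ`. -/
lemma gaussianSum_le {t : ℝ} (ht : 0 < t) :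
    gaussianSum t ≤ 1 + √(Real.pi / t) := by
  have hint : MeasureTheory.IntegrableOn (fun x : ℝ => Real.exp (-t * x ^ 2)) (Set.Ioi 0) :=
    (integrable_exp_neg_mul_sq ht).integrableOn
  have hnat : ∀ n : ℕ, ∑ k ∈ Finset.range n, Real.exp (-t * ((k + 1 : ℕ) : ℝ) ^ 2)
      ≤ √(Real.pi / t) / 2 := fun n => by
    have hanti : AntitoneOn (fun x : ℝ => Real.exp (-t * x ^ 2)) (Set.Icc 0 (0 + n)) := by
      intro x hx y _ hxy
      have : x ^ 2 ≤ y ^ 2 := pow_le_pow_left₀ hx.1 hxy 2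
      exact Real.exp_le_exp.mpr (by nlinarith)
    have h := hanti.sum_le_integral
    simp only [zero_add] at h
    refine h.trans ?_
    rw [← integral_gaussian_Ioi, intervalIntegral.integral_of_le (Nat.cast_nonneg n)]
    exact MeasureTheory.setIntegral_mono_set hint
      (Eventually.of_forall fun x => (Real.exp_pos _).le)
      (Eventually.of_forall fun x hx => hx.1)
  have hs := summable_exp_neg_mul_int_sq ht
  have hs1 : Summable fun k : ℕ => Real.exp (-t * ((k + 1 : ℕ) : ℝ) ^ 2) :=
    summable_of_sum_range_le (fun _ => (Real.exp_pos _).le) hnat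
  have hle := hs1.tsum_le_of_sum_range_le hnat
  have h1 : HasSum (fun k : ℤ => Real.exp (-t * (k : ℝ) ^ 2))
      ((∑' k : ℕ, Real.exp (-t * ((k + 1 : ℕ) : ℝ) ^ 2)) + Real.exp (-t * ((0 : ℤ) : ℝ) ^ 2) +
        ∑' k : ℕ, Real.exp (-t * ((k + 1 : ℕ) : ℝ) ^ 2)) := by
    refine HasSum.of_add_one_of_neg_add_one (f := fun k : ℤ => Real.exp (-t * (k : ℝ) ^ 2)) ?_ ?_
    · simpa using hs1.hasSum
    · refine hs1.hasSum.congr_fun fun k => ?_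
      push_cast
      ring_nf
  rw [gaussianSum, h1.tsum_eq]
  simp at hle ⊢
  linarith

end Theta

/-! ### The ideal gas without the zero mode -/

section IdealGas

lemma HasSum.swap {α γ : Type} {f : α × γ → ℝ} {s : ℝ} (h : HasSum f s) :
    HasSum (fun x : γ × α => f (x.2, x.1)) s :=
  (Equiv.prodComm γ α).hasSum_iff.mpr h

lemma hasSum_nonzeroMode_exp {t : ℝ} (ht : 0 < t) :
    HasSum (fun k : NonzeroMode => Real.exp (-t * ∑ i, (k.1 i : ℝ) ^ 2)) (gaussianSum t ^ 3 - 1) := by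
  have h : HasSum (fun k : Mode => ∏ i, Real.exp (-t * (k i : ℝ) ^ 2)) (gaussianSum t ^ 3) :=
    hasSum_prod_fin (fun k : ℤ => (Real.exp_pos (-t * (k : ℝ) ^ 2)).le)
      (summable_exp_neg_mul_int_sq ht).hasSum 3
  have h0 := h.sub (hasSum_ite_eq (0 : Mode) (1 : ℝ))
  refine (hasSum_subtype_iff_indicator (s := {k : Mode | k ≠ 0})
    (f := fun k : Mode => Real.exp (-t * ∑ i, (k i : ℝ) ^ 2))).mpr (h0.congr_fun fun k => ?_)
  by_cases hk : k = 0
  · simp [hk]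
  · simp [hk, ← Real.exp_sum, Finset.mul_sum]

/-- The fugacity factor `exp (-β (p²/2 - μ))`. -/
noncomputable def boltzmann (β μ ℓ : ℝ) (k : Mode) : ℝ :=
  Real.exp (-β * (‖momentum ℓ k‖ ^ 2 / 2 - μ))

/-- A power only rescales `β`, so the sum over momenta of each power splits into one-dimensional
Gaussian sums. -/
lemma boltzmann_pow (β μ ℓ : ℝ) (k : Mode) (j : ℕ) :
    boltzmann β μ ℓ k ^ j = Real.exp (β * μ * j) *
      Real.exp (-(2 * Real.pi ^ 2 * β * j / ℓ ^ 2) * ∑ i, (k i : ℝ) ^ 2) := by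
  rw [boltzmann, ← Real.exp_nat_mul, ← Real.exp_add, EuclideanSpace.norm_sq_eq]
  congr 1
  simp only [momentum, Fin.sum_univ_three, Real.norm_eq_abs, sq_abs]
  ring

lemma boltzmann_lt_one {β μ ℓ : ℝ} (hβ : 0 < β) (hμ : μ ≤ 0) (hℓ : 0 < ℓ) (k : NonzeroMode) :
    boltzmann β μ ℓ k.1 < 1 := by
  rw [boltzmann, Real.exp_lt_one_iff]
  have hne : momentum ℓ k.1 ≠ 0 := fun h => k.2 <| by
    ext i
    have := congrArg (fun v : EuclideanSpace ℝ (Fin 3) => v i) h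
    simpa [momentum, hℓ.ne', Real.pi_ne_zero] using this
  have := norm_pos_iff.mpr hne
  have h2 : 0 < ‖momentum ℓ k.1‖ ^ 2 / 2 - μ := by
    have : 0 < ‖momentum ℓ k.1‖ ^ 2 := by positivity
    linarith
  nlinarith

/-- The contribution of the `(j+1)`-fold windings to the logarithm of the partition function. -/
noncomputable def windingTerm (β μ ℓ : ℝ) (j : ℕ) : ℝ :=
  Real.exp (β * μ * (j + 1 : ℕ)) / ((j : ℝ) + 1) *
    (gaussianSum (2 * Real.pi ^ 2 * β * (j + 1 : ℕ) / ℓ ^ 2) ^ 3 - 1)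

lemma windingTerm_nonneg {β ℓ : ℝ} (μ : ℝ) (hβ : 0 < β) (hℓ : 0 < ℓ) (j : ℕ) :
    0 ≤ windingTerm β μ ℓ j := by
  have h := one_le_gaussianSum (t := 2 * Real.pi ^ 2 * β * (j + 1 : ℕ) / ℓ ^ 2) (by positivity)
  have := one_le_pow₀ h (n := 3)
  exact mul_nonneg (by positivity) (by linarith)

lemma sqrt_pi_div_winding {β ℓ : ℝ} (hβ : 0 < β) (hℓ : 0 < ℓ) (j : ℕ) :
    √(Real.pi / (2 * Real.pi ^ 2 * β * (j + 1 : ℕ) / ℓ ^ 2))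
      = ℓ * (√(Real.pi / (2 * Real.pi ^ 2 * β)) / √((j : ℝ) + 1)) := by
  have h : Real.pi / (2 * Real.pi ^ 2 * β * (j + 1 : ℕ) / ℓ ^ 2)
      = ℓ ^ 2 * (Real.pi / (2 * Real.pi ^ 2 * β) / ((j : ℝ) + 1)) := by
    have := Real.pi_pos
    push_cast
    field_simp
  rw [h, Real.sqrt_mul (by positivity), Real.sqrt_sq hℓ.le, Real.sqrt_div' _ (by positivity)]

/-- Removing the zero mode is what makes this summable at `μ = 0`: the cube minus `1` is of order `1
/ √(j + 1)`, whereas the zero mode would contribute the divergent series of `1 / (j + 1)`. -/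
lemma windingTerm_le {β μ ℓ : ℝ} (hβ : 0 < β) (hμ : μ ≤ 0) (hℓ : 0 < ℓ) (j : ℕ) :
    windingTerm β μ ℓ j ≤ ((1 + ℓ * √(Real.pi / (2 * Real.pi ^ 2 * β))) ^ 3 - 1) *
      (1 / (((j + 1 : ℕ) : ℝ) ^ (3 / 2 : ℝ))) := by
  set ρ := √(Real.pi / (2 * Real.pi ^ 2 * β)) with hρ
  set w := √((j : ℝ) + 1) with hw
  have hρ0 : 0 ≤ ρ := Real.sqrt_nonneg _
  have hw1 : 1 ≤ w := Real.one_le_sqrt.mpr (by linarith [(Nat.cast_nonneg j : (0 : ℝ) ≤ j)])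
  have hw0 : 0 < w := by linarith
  have ht : 0 < 2 * Real.pi ^ 2 * β * (j + 1 : ℕ) / ℓ ^ 2 := by positivity
  have h1 := gaussianSum_le ht
  rw [sqrt_pi_div_winding hβ hℓ, ← hρ, ← hw] at h1
  have hg0 := one_le_gaussianSum ht
  have h3 : gaussianSum (2 * Real.pi ^ 2 * β * (j + 1 : ℕ) / ℓ ^ 2) ^ 3 - 1
      ≤ ((1 + ℓ * ρ) ^ 3 - 1) / w := by
    have hcube := pow_le_pow_left₀ (by linarith) h1 3
    have hu0 : 0 ≤ 1 / w := by positivity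
    have hu1 : 1 / w ≤ 1 := (div_le_one hw0).mpr hw1
    have hr0 : 0 ≤ ℓ * ρ := by positivity
    -- With `u = 1 / w ≤ 1`, the polynomial `(1 + r u) ^ 3 - 1` has nonnegative coefficients and no
    -- constant term, so it is at most `u` times its value at `u = 1`.
    have hexp : (1 + ℓ * (ρ / w)) ^ 3 - 1 ≤ ((1 + ℓ * ρ) ^ 3 - 1) / w := by
      have e1 : ℓ * (ρ / w) = (ℓ * ρ) * (1 / w) := by ring
      rw [e1, div_eq_mul_one_div ((1 + ℓ * ρ) ^ 3 - 1) w]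
      generalize ℓ * ρ = r at *
      generalize 1 / w = u at *
      clear e1
      have hu2 : u ^ 2 ≤ u := by nlinarith
      have hu3 : u ^ 3 ≤ u := by nlinarith
      have := mul_le_mul_of_nonneg_left hu2 (by positivity : 0 ≤ 3 * r ^ 2)
      have := mul_le_mul_of_nonneg_left hu3 (by positivity : 0 ≤ r ^ 3)
      nlinarith
    linarith
  have hexp1 : Real.exp (β * μ * (j + 1 : ℕ)) ≤ 1 := by
    refine Real.exp_le_one_iff.mpr ?_
    exact mul_nonpos_of_nonpos_of_nonneg (mul_nonpos_of_nonneg_of_nonpos hβ.le hμ) (by positivity)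
  have hpow : (((j + 1 : ℕ) : ℝ) ^ (3 / 2 : ℝ)) = ((j : ℝ) + 1) * w := by
    rw [hw, Real.sqrt_eq_rpow, ← Real.rpow_one_add' (by positivity) (by norm_num)]
    norm_num
  rw [hpow, windingTerm]
  have hj : (0 : ℝ) < (j : ℝ) + 1 := by positivity
  have hcube1 := one_le_pow₀ hg0 (n := 3)
  calc _ ≤ 1 / ((j : ℝ) + 1) * (((1 + ℓ * ρ) ^ 3 - 1) / w) := by
        gcongr
    _ = _ := by field_simp

lemma summable_one_div_succ_rpow : Summable fun j : ℕ => 1 / (((j + 1 : ℕ) : ℝ) ^ (3 / 2 : ℝ)) :=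
  (summable_nat_add_iff 1).mpr (Real.summable_one_div_nat_rpow.mpr (by norm_num))

lemma summable_windingTerm {β μ ℓ : ℝ} (hβ : 0 < β) (hμ : μ ≤ 0) (hℓ : 0 < ℓ) :
    Summable (windingTerm β μ ℓ) :=
  Summable.of_nonneg_of_le (windingTerm_nonneg μ hβ hℓ) (windingTerm_le hβ hμ hℓ)
    (summable_one_div_succ_rpow.mul_left _)

/-- Both sides are iterated sums of one nonnegative double series over windings and modes. -/
lemma hasSum_neg_log_one_sub_boltzmann {β μ ℓ : ℝ} (hβ : 0 < β) (hμ : μ ≤ 0) (hℓ : 0 < ℓ) :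
    HasSum (fun k : NonzeroMode => -Real.log (1 - boltzmann β μ ℓ k.1))
      (∑' j, windingTerm β μ ℓ j) := by
  have hpos : ∀ k, 0 < boltzmann β μ ℓ k := fun k => Real.exp_pos _
  have hrow : ∀ j : ℕ, HasSum
      (fun k : NonzeroMode => boltzmann β μ ℓ k.1 ^ (j + 1) / ((j : ℝ) + 1))
      (windingTerm β μ ℓ j) := fun j => by
    have h := hasSum_nonzeroMode_exp (t := 2 * Real.pi ^ 2 * β * (j + 1 : ℕ) / ℓ ^ 2) (by positivity)
    refine (h.mul_left (Real.exp (β * μ * (j + 1 : ℕ)) / ((j : ℝ) + 1))).congr_fun fun k => ?_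
    rw [boltzmann_pow]
    ring
  have hprod : Summable fun x : ℕ × NonzeroMode =>
      boltzmann β μ ℓ x.2.1 ^ (x.1 + 1) / ((x.1 : ℝ) + 1) := by
    rw [summable_prod_of_nonneg (fun x => by have := hpos x.2.1; positivity)]
    exact ⟨fun j => (hrow j).summable, by
      simpa only [(hrow _).tsum_eq] using summable_windingTerm hβ hμ hℓ⟩
  have htot := hprod.hasSum
  have htot_eq := (htot.prod_fiberwise hrow).unique (summable_windingTerm hβ hμ hℓ).hasSum
  rw [htot_eq] at htot
  have hswap : HasSum (fun x : NonzeroMode × ℕ =>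
      boltzmann β μ ℓ x.1.1 ^ (x.2 + 1) / ((x.2 : ℝ) + 1)) (∑' j, windingTerm β μ ℓ j) :=
    htot.swap
  have hcol : ∀ k : NonzeroMode, HasSum
      (fun j : ℕ => boltzmann β μ ℓ k.1 ^ (j + 1) / ((j : ℝ) + 1))
      (-Real.log (1 - boltzmann β μ ℓ k.1)) := fun k =>
    Real.hasSum_pow_div_log_of_abs_lt_one <| by
      rw [abs_of_pos (hpos _)]
      exact boltzmann_lt_one hβ hμ hℓ k
  exact hswap.prod_fiberwise hcol

lemma tendsto_windingTerm_div {β : ℝ} (μ : ℝ) (hβ : 0 < β) (j : ℕ) :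
    ∃ c, Tendsto (fun ℓ : ℝ => windingTerm β μ ℓ j / ℓ ^ 3) atTop (𝓝 c) := by
  set ρ := √(Real.pi / (2 * Real.pi ^ 2 * β)) / √((j : ℝ) + 1) with hρ
  have hinv : Tendsto (fun ℓ : ℝ => ℓ⁻¹) atTop (𝓝 0) := tendsto_inv_atTop_zero
  have hg : Tendsto (fun ℓ : ℝ => gaussianSum (2 * Real.pi ^ 2 * β * (j + 1 : ℕ) / ℓ ^ 2) * ℓ⁻¹)
      atTop (𝓝 ρ) := by
    refine tendsto_of_tendsto_of_tendsto_of_le_of_le' tendsto_const_nhds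
      (by simpa using hinv.add_const ρ : Tendsto (fun ℓ : ℝ => ℓ⁻¹ + ρ) atTop (𝓝 ρ)) ?_ ?_
    · filter_upwards [eventually_gt_atTop 0] with ℓ hℓ
      have h := sqrt_pi_div_le_gaussianSum
        (t := 2 * Real.pi ^ 2 * β * (j + 1 : ℕ) / ℓ ^ 2) (by positivity)
      rw [sqrt_pi_div_winding hβ hℓ, ← hρ] at h
      rw [← div_eq_mul_inv, le_div_iff₀ hℓ, mul_comm]
      exact h
    · filter_upwards [eventually_gt_atTop 0] with ℓ hℓ
      have h := gaussianSum_le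
        (t := 2 * Real.pi ^ 2 * β * (j + 1 : ℕ) / ℓ ^ 2) (by positivity)
      rw [sqrt_pi_div_winding hβ hℓ, ← hρ] at h
      rw [← div_eq_mul_inv, div_le_iff₀ hℓ, add_mul, inv_mul_cancel₀ hℓ.ne', mul_comm ρ]
      exact h
  refine ⟨_, ((((hg.pow 3).sub (hinv.pow 3)).const_mul
    (Real.exp (β * μ * (j + 1 : ℕ)) / ((j : ℝ) + 1)))).congr fun ℓ => ?_⟩
  rw [windingTerm]
  ring

lemma exists_tendsto_tsum_windingTerm {β μ : ℝ} (hβ : 0 < β) (hμ : μ ≤ 0) :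
    ∃ c, Tendsto (fun ℓ : ℝ => (∑' j, windingTerm β μ ℓ j) / ℓ ^ 3) atTop (𝓝 c) := by
  choose c hc using tendsto_windingTerm_div μ hβ
  refine ⟨∑' j, c j, ?_⟩
  simp only [← tsum_div_const]
  set ρ := √(Real.pi / (2 * Real.pi ^ 2 * β)) with hρ
  have hρ0 : 0 ≤ ρ := Real.sqrt_nonneg _
  refine tendsto_tsum_of_dominated_convergence
    (summable_one_div_succ_rpow.mul_left ((1 + ρ) ^ 3)) hc ?_
  -- For `ℓ ≥ 1` one has `1 + ℓ ρ ≤ (1 + ρ) ℓ`, so the bound divided by `ℓ ^ 3` no longer depends on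
  -- `ℓ`.
  filter_upwards [eventually_ge_atTop 1] with ℓ hℓ j
  have hℓ0 : 0 < ℓ := by linarith
  rw [Real.norm_of_nonneg (div_nonneg (windingTerm_nonneg μ hβ hℓ0 j) (by positivity)),
    div_le_iff₀ (by positivity)]
  refine (windingTerm_le hβ hμ hℓ0 j).trans ?_
  have h1 : (1 + ℓ * ρ) ^ 3 ≤ ((1 + ρ) * ℓ) ^ 3 := by
    gcongr
    nlinarith
  rw [mul_pow] at h1
  rw [← hρ, mul_right_comm]
  exact mul_le_mul_of_nonneg_right (by linarith) (by positivity)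

end IdealGas

/-! ### The condensate -/

section Condensate

lemma isPositiveRoot_unique {a μ ν Δ y z : ℝ} (ha : 0 < a) (hν : 0 < ν)
    (hy : IsPositiveRoot a μ ν Δ y) (hz : IsPositiveRoot a μ ν Δ z) : y = z := by
  have key : ∀ {u v : ℝ}, IsPositiveRoot a μ ν Δ u → IsPositiveRoot a μ ν Δ v → ¬ u < v := by
    intro u v hu hv huv
    have hs : √u < √v := Real.sqrt_lt_sqrt hu.1.le huv
    have hs0 : 0 < √u := Real.sqrt_pos.mpr hu.1
    have h : ν / (2 * a * √v) < ν / (2 * a * √u) :=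
      div_lt_div_of_pos_left hν (by positivity) (by gcongr)
    linarith [hu.2, hv.2]
  exact le_antisymm (not_lt.mp (key hz hy)) (not_lt.mp (key hy hz))

/-- With `z = x ^ 2` the equation becomes the cubic `2 a x ^ 3 + (Δ - μ) x = ν`, to which the
intermediate value theorem applies. The endpoint `X` is at least `1` and satisfies `2 a X = 2 a + |Δ
- μ| + ν`, so its cubic term beats the others. -/
lemma exists_isPositiveRoot {a ν : ℝ} (μ Δ : ℝ) (ha : 0 < a) (hν : 0 < ν) :
    ∃ z, IsPositiveRoot a μ ν Δ z := by
  set X := 1 + (|Δ - μ| + ν) / (2 * a) with hX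
  have hX1 : 1 ≤ X := by
    have : 0 ≤ (|Δ - μ| + ν) / (2 * a) := by positivity
    linarith
  have hcont : ContinuousOn (fun x : ℝ => 2 * a * x ^ 3 + (Δ - μ) * x - ν) (Set.Icc 0 X) := by
    fun_prop
  have hXa : 2 * a * X = 2 * a + |Δ - μ| + ν := by
    rw [hX]
    field_simp
    ring
  have hpos : 0 ≤ 2 * a * X ^ 3 + (Δ - μ) * X - ν := by
    have h1 : -|Δ - μ| ≤ Δ - μ := neg_abs_le _
    have h2 : 2 * a * X ^ 3 = (2 * a + |Δ - μ| + ν) * X ^ 2 := by rw [← hXa]; ring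
    have h3 : X ≤ X ^ 2 := by nlinarith
    have h4 := mul_le_mul_of_nonneg_left h3 (abs_nonneg (Δ - μ))
    have h5 := mul_le_mul_of_nonneg_right h1 (by linarith : 0 ≤ X)
    have h6 := mul_le_mul_of_nonneg_left (hX1.trans h3) hν.le
    have h7 : 0 ≤ 2 * a * X ^ 2 := by positivity
    rw [h2]
    linarith
  obtain ⟨x, hx, hx0⟩ := intermediate_value_Icc (by linarith) hcont
    (show (0 : ℝ) ∈ Set.Icc _ _ from ⟨by simp [hν.le], hpos⟩)
  have hxpos : 0 < x := hx.1.lt_of_ne fun h => by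
    rw [← h] at hx0
    simp at hx0
    linarith
  refine ⟨x ^ 2, by positivity, ?_⟩
  rw [Real.sqrt_sq hxpos.le]
  simp only at hx0
  field_simp
  linarith

/-- The root equation says `g'(z₀) = 0`. The square root lies below its tangent at `z₀`, and the
quadratic part contributes exactly `-a (z - z₀) ^ 2`. -/
lemma g_le {a μ ν Δ z₀ z : ℝ} (hν : 0 < ν) (ha : 0 < a) (h : IsPositiveRoot a μ ν Δ z₀)
    (hz : 0 ≤ z) : g a μ ν Δ z ≤ g a μ ν Δ z₀ - a * (z - z₀) ^ 2 := by
  obtain ⟨h0, h1⟩ := h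
  set s := √z₀ with hs
  set t := √z with ht
  have hs0 : 0 < s := Real.sqrt_pos.mpr h0
  have hs2 : s ^ 2 = z₀ := Real.sq_sqrt h0.le
  have ht2 : t ^ 2 = z := Real.sq_sqrt hz
  have hslope : -2 * a * z₀ + (μ - Δ) + ν / s = 0 := by
    field_simp at h1 ⊢
    linarith
  have htan : 2 * t ≤ 2 * s + (z - z₀) / s := by
    have : 0 ≤ (t - s) ^ 2 / s := by positivity
    have e : (t - s) ^ 2 / s = 2 * s + (z - z₀) / s - 2 * t := by
      rw [← hs2, ← ht2]
      field_simp
      ring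
    linarith
  have h2 := mul_le_mul_of_nonneg_left htan hν.le
  have h3 : (-2 * a * z₀ + (μ - Δ) + ν / s) * (z - z₀) = 0 := by rw [hslope, zero_mul]
  have h4 : ν * (2 * s + (z - z₀) / s) = 2 * ν * s + ν / s * (z - z₀) := by ring
  simp only [g, ← hs, ← ht]
  nlinarith

/-- The energy of `m` particles in the zero mode, with the chemical potential included. -/
noncomputable def condensateEnergy (a μ ν Δ V : ℝ) (m : ℕ) : ℝ :=
  (Δ - μ) * m + a / V * (m * (m - 1)) - 2 * ν * √(V * m)

lemma neg_condensateEnergy (a μ ν Δ : ℝ) {V : ℝ} (hV : 0 < V) (m : ℕ) :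
    -condensateEnergy a μ ν Δ V m = V * g a μ ν Δ (m / V) + a * (m / V) := by
  have h : √(V * m) = V * √(m / V) := by
    rw [show V * m = V ^ 2 * (m / V) by field_simp, Real.sqrt_mul (by positivity),
      Real.sqrt_sq hV.le]
  rw [condensateEnergy, g, h]
  field_simp
  ring

/-- The boundary term in the upper bound for the condensate partition function. -/
noncomputable def condensateSlack (β a z₀ V : ℝ) : ℝ :=
  (β * a + 2) * z₀ + (β * a + 2) ^ 2 / (4 * (β * a * V)) + 2 * Real.log (1 + V)

/-- The quadratic gap in `g_le` pays for a summable factor `(m + 1) ^ (-2)`, at a cost in the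
exponent that is `o(V)`. -/
lemma exp_condensateEnergy_le {β a μ ν Δ z₀ V : ℝ} (hβ : 0 < β) (ha : 0 < a) (hν : 0 < ν)
    (h : IsPositiveRoot a μ ν Δ z₀) (hV : 0 < V) (m : ℕ) :
    Real.exp (-β * condensateEnergy a μ ν Δ V m) ≤
      Real.exp (β * V * g a μ ν Δ z₀ + condensateSlack β a z₀ V) *
        (1 / ((m + 1 : ℕ) : ℝ) ^ 2) := by
  have hm : (0 : ℝ) < (m + 1 : ℕ) := by positivity
  have hz : 0 ≤ (m : ℝ) / V := by positivity
  -- From `1 + m ≤ (1 + V) (1 + m / V)` and `log (1 + x) ≤ x`.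
  have hlog : Real.log (m + 1 : ℕ) ≤ Real.log (1 + V) + m / V := by
    have h1 : ((m + 1 : ℕ) : ℝ) ≤ (1 + V) * (1 + m / V) := by
      have : (1 + V) * (1 + m / V) = 1 + V + m / V + m := by field_simp; ring
      rw [this]
      push_cast
      linarith
    have h2 := Real.log_le_log hm h1
    rw [Real.log_mul (by positivity) (by positivity)] at h2
    have h3 := Real.log_le_sub_one_of_pos (show 0 < 1 + (m : ℝ) / V by positivity)
    linarith
  have hrw : 1 / ((m + 1 : ℕ) : ℝ) ^ 2 = Real.exp (-(2 * Real.log (m + 1 : ℕ))) := by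
    rw [Real.exp_neg, mul_comm, Real.exp_mul, Real.exp_log hm, one_div, Real.rpow_two]
  rw [hrw, ← Real.exp_add, Real.exp_le_exp, neg_mul, ← mul_neg, neg_condensateEnergy _ _ _ _ hV,
    condensateSlack]
  have hg := mul_le_mul_of_nonneg_left (g_le hν ha h hz) (mul_pos hβ hV).le
  generalize (m : ℝ) / V = z at *
  -- In the slope, `β a` comes from having `m (m - 1)` in place of `m ^ 2`, and `2` from the factor
  -- `(m + 1) ^ (-2)`. Completing the square absorbs it into the gap.
  have hq : (β * a + 2) * (z - z₀) ≤
      β * a * V * (z - z₀) ^ 2 + (β * a + 2) ^ 2 / (4 * (β * a * V)) := by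
    have hA : 0 < β * a * V := by positivity
    generalize β * a * V = A at *
    generalize β * a + 2 = c at *
    have : 0 ≤ (2 * A * (z - z₀) - c) ^ 2 / (4 * A) := by positivity
    have e : (2 * A * (z - z₀) - c) ^ 2 / (4 * A)
        = A * (z - z₀) ^ 2 + c ^ 2 / (4 * A) - c * (z - z₀) := by
      field_simp
      ring
    linarith
  linarith

lemma summable_one_div_succ_sq : Summable fun m : ℕ => 1 / ((m + 1 : ℕ) : ℝ) ^ 2 :=
  (summable_nat_add_iff 1).mpr (Real.summable_one_div_nat_pow.mpr one_lt_two)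

lemma summable_exp_condensateEnergy {β a ν V : ℝ} (μ Δ : ℝ) (hβ : 0 < β) (ha : 0 < a) (hν : 0 < ν)
    (hV : 0 < V) : Summable fun m : ℕ => Real.exp (-β * condensateEnergy a μ ν Δ V m) := by
  obtain ⟨z₀, h⟩ := exists_isPositiveRoot μ Δ ha hν
  exact Summable.of_nonneg_of_le (fun m => (Real.exp_pos _).le)
    (exp_condensateEnergy_le hβ ha hν h hV) (summable_one_div_succ_sq.mul_left _)

lemma tendsto_condensate_pressure {β a μ ν Δ z₀ : ℝ} (hβ : 0 < β) (ha : 0 < a) (hν : 0 < ν)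
    (h : IsPositiveRoot a μ ν Δ z₀) :
    Tendsto (fun V : ℝ => 1 / (β * V) *
      Real.log (∑' m : ℕ, Real.exp (-β * condensateEnergy a μ ν Δ V m))) atTop
      (𝓝 (g a μ ν Δ z₀)) := by
  set S := ∑' m : ℕ, 1 / ((m + 1 : ℕ) : ℝ) ^ 2 with hS
  have hS0 : 0 < S := summable_one_div_succ_sq.tsum_pos (fun m => by positivity) 0 (by simp)
  have hlow : Tendsto (fun V : ℝ => g a μ ν Δ ((⌊z₀ * V⌋₊ : ℝ) / V)) atTop (𝓝 (g a μ ν Δ z₀)) := by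
    have hc : Continuous (g a μ ν Δ) := by
      unfold g
      fun_prop
    exact (hc.tendsto _).comp (tendsto_nat_floor_mul_div_atTop h.1.le)
  have hinv : Tendsto (fun V : ℝ => V⁻¹) atTop (𝓝 0) := tendsto_inv_atTop_zero
  have hlogdiv : Tendsto (fun V : ℝ => Real.log (1 + V) * V⁻¹) atTop (𝓝 0) := by
    have h1 := (Real.isLittleO_log_id_atTop.tendsto_div_nhds_zero).comp
      (tendsto_atTop_add_const_left atTop (1 : ℝ) tendsto_id)
    have h2 := h1.mul (hinv.const_add 1)
    rw [zero_mul] at h2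
    refine h2.congr' ?_
    filter_upwards [eventually_gt_atTop 0] with V hV
    simp only [Function.comp, id]
    have : 1 + V ≠ 0 := by positivity
    field_simp
    ring
  have hup : Tendsto (fun V : ℝ => g a μ ν Δ z₀ + β⁻¹ * (((β * a + 2) * z₀ + Real.log S) * V⁻¹
      + (β * a + 2) ^ 2 / (4 * (β * a)) * V⁻¹ ^ 2 + 2 * (Real.log (1 + V) * V⁻¹))) atTop
      (𝓝 (g a μ ν Δ z₀)) := by
    have h1 := ((hinv.const_mul ((β * a + 2) * z₀ + Real.log S)).add
      ((hinv.pow 2).const_mul ((β * a + 2) ^ 2 / (4 * (β * a))))).add (hlogdiv.const_mul 2)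
    simpa using (h1.const_mul β⁻¹).const_add (g a μ ν Δ z₀)
  refine tendsto_of_tendsto_of_tendsto_of_le_of_le' hlow hup ?_ ?_
  · filter_upwards [eventually_gt_atTop 0] with V hV
    -- Lower bound: one term, at density close to `z₀`; its nonnegative correction `a m / V` is
    -- dropped below.
    have hle := (summable_exp_condensateEnergy μ Δ hβ ha hν hV).le_tsum ⌊z₀ * V⌋₊
      fun _ _ => (Real.exp_pos _).le
    have hlog := Real.log_le_log (Real.exp_pos _) hle
    rw [Real.log_exp, neg_mul, ← mul_neg, neg_condensateEnergy _ _ _ _ hV] at hlog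
    rw [one_div_mul_eq_div, le_div_iff₀ (by positivity)]
    have : 0 ≤ a * ((⌊z₀ * V⌋₊ : ℝ) / V) := by positivity
    nlinarith
  · filter_upwards [eventually_gt_atTop 0] with V hV
    have hs := summable_exp_condensateEnergy μ Δ hβ ha hν hV
    have hle := hs.tsum_le_tsum (exp_condensateEnergy_le hβ ha hν h hV)
      (summable_one_div_succ_sq.mul_left _)
    rw [tsum_mul_left, ← hS] at hle
    have hlog := Real.log_le_log (hs.tsum_pos (fun m => (Real.exp_pos _).le) 0 (Real.exp_pos _)) hle
    rw [Real.log_mul (Real.exp_pos _).ne' hS0.ne', Real.log_exp, condensateSlack] at hlog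
    rw [one_div_mul_eq_div, div_le_iff₀ (by positivity)]
    refine hlog.trans (le_of_eq ?_)
    field_simp
    ring

end Condensate

/-! ### Partition functions -/

section PartitionFunctions

lemma vol_pos {ℓ : ℝ} (hℓ : 0 < ℓ) : 0 < vol ℓ := pow_pos hℓ 3

lemma modeSum_apply {M : Type} (e : M → ℝ) (ψ : Occ M → ℂ) (n : Occ M) :
    modeSum e ψ n = ((n.sum fun p k => e p * k : ℝ) : ℂ) * ψ n := by
  simp only [modeSum, LinearMap.coe_mk, AddHom.coe_mk, number_apply, Finsupp.sum]
  push_cast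
  rw [Finset.sum_mul]
  exact Finset.sum_congr rfl fun p _ => (mul_assoc _ _ _).symm

/-- Regroup as `a† (a† a) a`: the inner number operator sees one particle fewer. The empty mode is
treated apart because subtraction of occupations is truncated. -/
lemma creation_sq_mul_annihilation_sq_apply {M : Type} (p : M) (ψ : Occ M → ℂ) (n : Occ M) :
    (creation p ^ 2 * annihilation p ^ 2) ψ n = ((n p * (n p - 1) : ℝ) : ℂ) * ψ n := by
  have h1 : (creation p ^ 2 * annihilation p ^ 2) ψ
      = creation p (number p (annihilation p ψ)) := rfl
  have h2 : ∀ φ : Occ M → ℂ,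
      creation p φ n = (√(n p : ℝ) : ℂ) * φ (n - Finsupp.single p 1) := fun _ => rfl
  have h3 : (n p : ℂ) * ψ n
      = (√(n p : ℝ) : ℂ) * annihilation p ψ (n - Finsupp.single p 1) := by
    rw [← number_apply, ← h2]
    rfl
  rw [h1, h2, number_apply]
  rcases Nat.eq_zero_or_pos (n p) with h | h
  · simp [h]
  · have h4 : ((n - Finsupp.single p 1 : Occ M) p : ℂ) = (n p : ℂ) - 1 := by
      simp [Nat.cast_sub (Nat.one_le_iff_ne_zero.mpr h.ne')]
    rw [h4, mul_left_comm, ← h3]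
    push_cast
    ring

lemma idealGrand'_apply (ℓ μ : ℝ) (ψ : Occ NonzeroMode → ℂ) (n : Occ NonzeroMode) :
    (idealHamiltonian' ℓ - (μ : ℂ) • totalNumber : FormalOp NonzeroMode) ψ n =
      ((n.sum fun p k => (‖momentum ℓ p.1‖ ^ 2 / 2 - μ) * k : ℝ) : ℂ) * ψ n := by
  simp only [idealHamiltonian', totalNumber, LinearMap.sub_apply, LinearMap.smul_apply,
    Pi.sub_apply, Pi.smul_apply, modeSum_apply, smul_eq_mul, sub_mul, Finsupp.sum_sub]
  simp only [Finsupp.sum, one_mul, ← Finset.mul_sum]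
  push_cast
  ring

lemma perturbedGrand_apply (ℓ Δ a ν μ : ℝ) (ψ : Occ Mode → ℂ) (n : Occ Mode) :
    (perturbedHamiltonian ℓ Δ a ν - (μ : ℂ) • totalNumber : FormalOp Mode) ψ n =
      (((n.sum fun p k => (energy ℓ Δ p - μ) * k) + a / vol ℓ * (n 0 * (n 0 - 1))
        - 2 * ν * √(vol ℓ * n 0) : ℝ) : ℂ) * ψ n := by
  have hf : funNumber (fun x => √(vol ℓ * x)) (0 : Mode) ψ n = (√(vol ℓ * n 0) : ℂ) * ψ n := rfl
  simp only [perturbedHamiltonian, totalNumber, LinearMap.sub_apply, LinearMap.add_apply,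
    LinearMap.smul_apply, Pi.sub_apply, Pi.add_apply, Pi.smul_apply, modeSum_apply, smul_eq_mul,
    creation_sq_mul_annihilation_sq_apply, hf, sub_mul, Finsupp.sum_sub]
  simp only [Finsupp.sum, one_mul, ← Finset.mul_sum]
  push_cast
  ring

lemma exp_neg_sum_eq_prod_pow {M : Type} (β : ℝ) (e : M → ℝ) (n : M →₀ ℕ) :
    Real.exp (-β * n.sum fun p k => e p * k) = n.prod fun p k => Real.exp (-β * e p) ^ k := by
  rw [Finsupp.sum, Finsupp.prod, Finset.mul_sum, Real.exp_sum]
  refine Finset.prod_congr rfl fun p _ => ?_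
  rw [← Real.exp_nat_mul]
  ring_nf

lemma hasSum_exp_ideal {β μ ℓ : ℝ} (hβ : 0 < β) (hμ : μ ≤ 0) (hℓ : 0 < ℓ) :
    HasSum (fun n : Occ NonzeroMode =>
        Real.exp (-β * n.sum fun p k => (‖momentum ℓ p.1‖ ^ 2 / 2 - μ) * k))
      (Real.exp (∑' j, windingTerm β μ ℓ j)) := by
  have h := hasSum_prod_pow (x := fun p : NonzeroMode => boltzmann β μ ℓ p.1)
    (fun p => (Real.exp_pos _).le) (boltzmann_lt_one hβ hμ hℓ)
    (hasSum_neg_log_one_sub_boltzmann hβ hμ hℓ)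
  exact h.congr_fun fun n => exp_neg_sum_eq_prod_pow β _ n

lemma hasSum_exp_perturbed {β a μ ν ℓ : ℝ} (Δ : ℝ) (hβ : 0 < β) (ha : 0 < a) (hμ : μ ≤ 0)
    (hν : 0 < ν) (hℓ : 0 < ℓ) :
    HasSum (fun n : Occ Mode => Real.exp (-β *
        ((n.sum fun p k => (energy ℓ Δ p - μ) * k) + a / vol ℓ * (n 0 * (n 0 - 1))
          - 2 * ν * √(vol ℓ * n 0))))
      ((∑' m : ℕ, Real.exp (-β * condensateEnergy a μ ν Δ (vol ℓ) m)) *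
        Real.exp (∑' j, windingTerm β μ ℓ j)) := by
  have h := hasSum_option_occupation (fun m => (Real.exp_pos _).le)
    (fun n => (Real.exp_pos _).le)
    (summable_exp_condensateEnergy μ Δ hβ ha hν (vol_pos hℓ)).hasSum
    (hasSum_exp_ideal hβ hμ hℓ)
  -- Viewing `Mode` as `Option NonzeroMode`, with `none` the zero mode, turns the sum into the
  -- product form of `hasSum_option_occupation`.
  rw [← (Finsupp.domCongr (M := ℕ) (Equiv.optionSubtypeNe (0 : Mode))).toEquiv.hasSum_iff]
  refine h.congr_fun fun n => ?_
  have hzero : (Finsupp.domCongr (M := ℕ) (Equiv.optionSubtypeNe (0 : Mode))).toEquiv n 0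
      = n none := by
    change n ((Equiv.optionSubtypeNe (0 : Mode)).symm 0) = n none
    rw [Equiv.optionSubtypeNe_symm_self]
  have hsum : ((Finsupp.domCongr (M := ℕ) (Equiv.optionSubtypeNe (0 : Mode))).toEquiv n).sum
      (fun p k => (energy ℓ Δ p - μ) * k) = (Δ - μ) * n none
        + n.some.sum fun p k => (‖momentum ℓ p.1‖ ^ 2 / 2 - μ) * k := by
    refine (Finsupp.sum_equivMapDomain _ _ _).trans ?_
    rw [Finsupp.sum_option_index _ _ (by simp) (by intros; push_cast; ring)]
    have hnone : energy ℓ Δ (Equiv.optionSubtypeNe (0 : Mode) none) = Δ := if_pos rfl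
    have hsome : ∀ p : NonzeroMode, energy ℓ Δ (Equiv.optionSubtypeNe (0 : Mode) (some p))
        = ‖momentum ℓ p.1‖ ^ 2 / 2 := fun p => if_neg p.2
    simp only [hnone, hsome]
  simp only [Function.comp]
  rw [hzero, hsum, ← Real.exp_add, condensateEnergy]
  congr 1
  ring

lemma hasGibbsState_ideal {β μ ℓ : ℝ} (hβ : 0 < β) (hμ : μ ≤ 0) (hℓ : 0 < ℓ) :
    HasGibbsState β (idealGrand' ℓ μ) ∧
      trace (expNeg β (idealGrand' ℓ μ)) = (Real.exp (∑' j, windingTerm β μ ℓ j) : ℝ) :=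
  hasGibbsState_diagonal (idealGrand'_apply ℓ μ) (hasSum_exp_ideal hβ hμ hℓ)

lemma hasGibbsState_perturbed {β a μ ν ℓ : ℝ} (Δ : ℝ) (hβ : 0 < β) (ha : 0 < a) (hμ : μ ≤ 0)
    (hν : 0 < ν) (hℓ : 0 < ℓ) :
    HasGibbsState β (perturbedGrand ℓ Δ a ν μ) ∧
      trace (expNeg β (perturbedGrand ℓ Δ a ν μ)) =
        ((∑' m : ℕ, Real.exp (-β * condensateEnergy a μ ν Δ (vol ℓ) m)) *
          Real.exp (∑' j, windingTerm β μ ℓ j) : ℝ) :=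
  hasGibbsState_diagonal (perturbedGrand_apply ℓ Δ a ν μ)
    (hasSum_exp_perturbed Δ hβ ha hμ hν hℓ)

lemma pressure_ideal {β μ ℓ : ℝ} (hβ : 0 < β) (hμ : μ ≤ 0) (hℓ : 0 < ℓ) :
    pressure β (vol ℓ) (idealGrand' ℓ μ) = β⁻¹ * ((∑' j, windingTerm β μ ℓ j) / ℓ ^ 3) := by
  rw [pressure, (hasGibbsState_ideal hβ hμ hℓ).2, Complex.ofReal_re, Real.log_exp, vol]
  ring

lemma pressure_perturbed {β a μ ν ℓ : ℝ} (Δ : ℝ) (hβ : 0 < β) (ha : 0 < a) (hμ : μ ≤ 0)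
    (hν : 0 < ν) (hℓ : 0 < ℓ) :
    pressure β (vol ℓ) (perturbedGrand ℓ Δ a ν μ) =
      1 / (β * vol ℓ) * Real.log (∑' m : ℕ, Real.exp (-β * condensateEnergy a μ ν Δ (vol ℓ) m))
        + pressure β (vol ℓ) (idealGrand' ℓ μ) := by
  have hpos := (summable_exp_condensateEnergy μ Δ hβ ha hν (vol_pos hℓ)).tsum_pos
    (fun m => (Real.exp_pos _).le) 0 (Real.exp_pos _)
  rw [pressure, pressure, (hasGibbsState_ideal hβ hμ hℓ).2,
    (hasGibbsState_perturbed Δ hβ ha hμ hν hℓ).2, Complex.ofReal_re, Complex.ofReal_re,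
    Real.log_mul hpos.ne' (Real.exp_pos _).ne', mul_add]

end PartitionFunctions

theorem theorem1 (β a μ ν Δ : ℝ) (hβ : 0 < β) (ha : 0 < a) (hμ : μ ≤ 0) (hν : 0 < ν) :
    (∀ ℓ : ℝ, 0 < ℓ →
      HasGibbsState β (perturbedGrand ℓ Δ a ν μ) ∧ HasGibbsState β (idealGrand' ℓ μ)) ∧
    ∃ z₀ pId' : ℝ,
      (IsPositiveRoot a μ ν Δ z₀ ∧ ∀ z : ℝ, IsPositiveRoot a μ ν Δ z → z = z₀) ∧
      Tendsto (fun ℓ : ℝ => pressure β (vol ℓ) (idealGrand' ℓ μ)) atTop (𝓝 pId') ∧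
      Tendsto (fun ℓ : ℝ => pressure β (vol ℓ) (perturbedGrand ℓ Δ a ν μ)) atTop
        (𝓝 (g a μ ν Δ z₀ + pId')) := by
  refine ⟨fun ℓ hℓ => ⟨(hasGibbsState_perturbed Δ hβ ha hμ hν hℓ).1,
    (hasGibbsState_ideal hβ hμ hℓ).1⟩, ?_⟩
  obtain ⟨z₀, hz₀⟩ := exists_isPositiveRoot μ Δ ha hν
  obtain ⟨c, hc⟩ := exists_tendsto_tsum_windingTerm hβ hμ
  have hideal : Tendsto (fun ℓ : ℝ => pressure β (vol ℓ) (idealGrand' ℓ μ)) atTop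
      (𝓝 (β⁻¹ * c)) := by
    refine (hc.const_mul β⁻¹).congr' ?_
    filter_upwards [eventually_gt_atTop 0] with ℓ hℓ
    exact (pressure_ideal hβ hμ hℓ).symm
  have hvol : Tendsto vol atTop atTop := tendsto_pow_atTop three_ne_zero
  refine ⟨z₀, β⁻¹ * c, ⟨hz₀, fun z hz => isPositiveRoot_unique ha hν hz hz₀⟩, hideal, ?_⟩
  refine (((tendsto_condensate_pressure hβ ha hν hz₀).comp hvol).add hideal).congr' ?_
  filter_upwards [eventually_gt_atTop 0] with ℓ hℓ
  exact (pressure_perturbed Δ hβ ha hμ hν hℓ).symm
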